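/- Let $V=\{1,\dots,p\}$ and let $F:2^V\to\mathbb{R}$ be submodular with $F(\varnothing)=F(V)=0$ and $F(A)>0$ for every $A\subset V$ with $A\neq\varnothing,V$. Let $f(w)=\int_{\mathbb{R}}F(\{k: w_k\geqslant\alpha\})\,d\alpha$ be its Lovász extension on $\mathbb{R}^p$, and let $\mathcal{U}=\{w\in\mathbb{R}^p: f(w)\leqslant 1\}$. A lattice is a family $\mathcal{D}\subset 2^V$ that contains $\varnothing$ and $V$ and is closed under union and intersection. The differences $T\setminus S$, where $S\subsetneq T$ are members of $\mathcal{D}$ with no member of $\mathcal{D}$ strictly between them, form a partition $\Pi(\mathcal{D})=\{A_1,\dots,A_m\}$ of $V$ (its elements are called blocks). It is partially ordered by: $A_j\succcurlyeq A_i$ if every member of $\mathcal{D}$ that contains $A_j$ contains $A_i$. (The members of $\mathcal{D}$ are thus the unions of the down-closed sets of blocks.) The ancestors of $A_j$ are the blocks $A_i\neq A_j$ with $A_j\succcurlyeq A_i$. A set $A$ is inseparable for a set-function $H$ if there is no partition of $A$ into two non-empty sets $B$, $C$ with $H(A)=H(B)+H(C)$. Let $\mathcal{U}^\circ_{\mathcal{D}}$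 be the set of $w\in\mathbb{R}^p$ that are constant on each block, with value $v_j$ on $A_j$, and satisfy $v_i>v_j$ whenever $A_i$ is an ancestor of $A_j$. Then the non-empty relative interiors of the faces $G\neq\mathcal{U}$ of $\mathcal{U}$ are exactly the sets $\mathcal{U}^\circ_{\mathcal{D}}\cap\{f=1\}$, where $\mathcal{D}\neq\{\varnothing,V\}$ is a lattice such that (i) $F(A)+F(B)=F(A\cup B)+F(A\cap B)$ for all $A,B\in\mathcal{D}$; (ii) for every $j$, the block $A_j$ is inseparable for $C\mapsto F(B_{j-1}\cup C)-F(B_{j-1})$, where $B_{j-1}$ denotes the union of the ancestors of $A_j$; (iii) $\mathcal{D}$ is maximal for inclusion among the lattices that have the same unordered partition and satisfy (i) and (ii). Moreover, the relative interior of the remaining face, $\mathcal{U}$ itself, is $\{f<1\}$. -/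

import Mathlib

open MeasureTheory

section Submodular

variable {V : Type*} [Fintype V] [DecidableEq V]

/-- The set-function `F` is submodular. -/
def IsSubmodular (F : Finset V → ℝ) : Prop :=
  ∀ A B : Finset V, F (A ∪ B) + F (A ∩ B) ≤ F A + F B

/-- The Lovász extension `f(w) = ∫ F({w ≥ α}) dα` of a set-function `F` that vanishes at the
empty set and at the full set (the integrand is then a step function of bounded support). -/
noncomputable def lovasz (F : Finset V → ℝ) (w : V → ℝ) : ℝ :=
  ∫ α : ℝ, F (Finset.univ.filter (fun k => α ≤ w k))

/-- The unit ball `U = {f ≤ 1}`. -/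
def unitBall (F : Finset V → ℝ) : Set (V → ℝ) := {w | lovasz F w ≤ 1}

/-- A face of a convex set `C`: a convex subset `G` such that every segment of `C` with a relative
interior point in `G` lies in `G`. (For polyhedra these are the intersections with supporting
hyperplanes, together with `∅` and `C`.) -/
def IsFace (C G : Set (V → ℝ)) : Prop := Convex ℝ G ∧ IsExtreme ℝ C G

/-- `A` is inseparable for `H`: there is no partition of `A` into two non-empty sets `B`, `C`
with `H A = H B + H C`. -/
def IsInseparable (H : Finset V → ℝ) (A : Finset V) : Prop :=
  ¬ ∃ B C : Finset V, B.Nonempty ∧ C.Nonempty ∧ Disjoint B C ∧ B ∪ C = A ∧ H A = H B + H C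

/-- A (distributive) lattice of subsets of `V` that contains the empty set and the full set. -/
structure IsSetLattice (D : Set (Finset V)) : Prop where
  empty_mem : ∅ ∈ D
  univ_mem : Finset.univ ∈ D
  union_mem : ∀ S ∈ D, ∀ T ∈ D, S ∪ T ∈ D
  inter_mem : ∀ S ∈ D, ∀ T ∈ D, S ∩ T ∈ D

/-- The unordered partition of `V` given by `D`: the differences `T \ S` of consecutive sets
`S ⊂ T` in the maximal chains of `D`, i.e. of pairs with no member of `D` strictly in between. -/
def blocks (D : Set (Finset V)) : Set (Finset V) :=
  {A | ∃ S ∈ D, ∃ T ∈ D, S ⊂ T ∧ (∀ R ∈ D, ¬ (S ⊂ R ∧ R ⊂ T)) ∧ A = T \ S}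

/-- `A'` is strictly lower than `A` in the poset of blocks of `D` (an ancestor of `A`): the blocks
differ and every member of `D` containing `A` contains `A'`. This is the order for which the
members of `D` are the unions of the ideals (down-closed sets) of blocks. -/
def IsAncestor (D : Set (Finset V)) (A' A : Finset V) : Prop :=
  A' ∈ blocks D ∧ A ∈ blocks D ∧ A' ≠ A ∧ ∀ T ∈ D, A ⊆ T → A' ⊆ T

open Classical in
/-- The union of all ancestors of the block `A`. -/
noncomputable def ancestorUnion (D : Set (Finset V)) (A : Finset V) : Finset V :=
  Finset.univ.filter (fun k => ∃ A', IsAncestor D A' A ∧ k ∈ A')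

/-- The restriction of `F` to `D` is modular. -/
def IsModularOn (F : Finset V → ℝ) (D : Set (Finset V)) : Prop :=
  ∀ A ∈ D, ∀ B ∈ D, F A + F B = F (A ∪ B) + F (A ∩ B)

/-- Every block `A` of `D` is inseparable for `C ↦ F (B ∪ C) - F B`, where `B` is the union of the
ancestors of `A`. -/
def HasInseparableBlocks (F : Finset V → ℝ) (D : Set (Finset V)) : Prop :=
  ∀ A ∈ blocks D,
    IsInseparable (fun C => F (ancestorUnion D A ∪ C) - F (ancestorUnion D A)) A

/-- `D` is a lattice satisfying (i) modularity of `F` on `D`, (ii) inseparability of the blocks and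
(iii) maximality, for inclusion, among the lattices with the same unordered partition that
satisfy (i) and (ii). -/
structure IsAllowedLattice (F : Finset V → ℝ) (D : Set (Finset V)) : Prop where
  isSetLattice : IsSetLattice D
  modular : IsModularOn F D
  inseparable : HasInseparableBlocks F D
  maximal : ∀ D' : Set (Finset V), IsSetLattice D' → blocks D' = blocks D →
    IsModularOn F D' → HasInseparableBlocks F D' → D ⊆ D' → D' = D

/-- The open cone attached to `D`: vectors `w` that are constant on every block `A` of `D`, with
value `v A`, and such that the value on a block is strictly smaller than on each of its
ancestors. Thus the level sets `{w ≥ α}` belong to `D`. -/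
def openCone (D : Set (Finset V)) : Set (V → ℝ) :=
  {w | ∃ v : Finset V → ℝ, (∀ A ∈ blocks D, ∀ k ∈ A, w k = v A) ∧
    ∀ A' A, IsAncestor D A' A → v A < v A'}

end Submodular

/-! The function f is the support function of the base polytope of `F`: every base lies below f as a
linear form, and the greedy algorithm produces a base that attains f at a given w. The set of bases
attaining f at w (`maximizers F w`) therefore records which linear inequalities defining the ball
are active there, and the relative interiors of the proper faces are the classes of points of {f =
1} with equal maximizers (`intrinsicInterior_proper_faces`).

These classes have a combinatorial description. A base is a maximizer at w exactly when every
superlevel set of w is tight for it (`mem_maximizers_iff`). The sets tight at all maximizers form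
`tightLattice F w`. Since the slack of a base is non-negative and submodular, this is a lattice on
which `F` is modular; an additional separation of a block would create a further tight set, and a
larger modular lattice with the same blocks has only tight members. So it is allowed, and its open
cone is the class of w (`mem_openCone_tightLattice_iff`).

Conversely, an allowed lattice is the tight lattice of each point of its open cone
(`IsAllowedLattice.tightLattice_eq`): modularity makes its members tight, inseparability prevents
tight sets from cutting its blocks, and maximality gives equality. Positivity of `F` makes 0 a base,
and this excludes exactly the trivial lattice on {f = 1}. -/

/-! ### Relative interiors of convex sets -/

section IntrinsicInterior

open Topology

variable {E : Type*} [NormedAddCommGroup E] [NormedSpace ℝ E]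

/-- A point is in the intrinsic interior when all nearby points of the affine span are in the
set. -/
theorem mem_intrinsicInterior_iff_eventually {s : Set E} {x : E} :
    x ∈ intrinsicInterior ℝ s ↔
      x ∈ affineSpan ℝ s ∧ ∀ᶠ y in 𝓝 x, y ∈ affineSpan ℝ s → y ∈ s := by
  rw [mem_intrinsicInterior]
  constructor
  · rintro ⟨y, hy, rfl⟩
    refine ⟨y.2, ?_⟩
    rw [mem_interior_iff_mem_nhds, mem_nhds_subtype] at hy
    obtain ⟨u, hu, hus⟩ := hy
    filter_upwards [hu] with z hz hzs
    exact hus (show (⟨z, hzs⟩ : affineSpan ℝ s) ∈ Subtype.val ⁻¹' u from hz)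
  · rintro ⟨hx, h⟩
    refine ⟨⟨x, hx⟩, ?_, rfl⟩
    rw [mem_interior_iff_mem_nhds, mem_nhds_subtype]
    exact ⟨_, h, fun z hz => hz z.2⟩

theorem add_smul_sub_mem_affineSpan {s : Set E} {x y : E} (hx : x ∈ affineSpan ℝ s)
    (hy : y ∈ affineSpan ℝ s) (c : ℝ) : x + c • (y - x) ∈ affineSpan ℝ s := by
  have h := AffineMap.lineMap_mem c hx hy
  rwa [AffineMap.lineMap_apply, vsub_eq_sub, vadd_eq_add, add_comm] at h

/-- The algebraic description of the intrinsic interior of a finite-dimensional convex set: the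
points beyond which every segment of the set can be prolonged. -/
theorem Convex.mem_intrinsicInterior_iff [FiniteDimensional ℝ E] {s : Set E} (hs : Convex ℝ s)
    {x : E} :
    x ∈ intrinsicInterior ℝ s ↔ x ∈ s ∧ ∀ u ∈ s, ∃ ε : ℝ, 0 < ε ∧ x + ε • (x - u) ∈ s := by
  constructor
  · intro hx
    have hxs := intrinsicInterior_subset hx
    refine ⟨hxs, fun u hu => ?_⟩
    obtain ⟨hx1, hx2⟩ := mem_intrinsicInterior_iff_eventually.1 hx
    have hc : Filter.Tendsto (fun ε : ℝ => x + ε • (x - u)) (𝓝[>] 0) (𝓝 x) := by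
      have : Continuous (fun ε : ℝ => x + ε • (x - u)) := by fun_prop
      simpa using (this.tendsto 0).mono_left nhdsWithin_le_nhds
    obtain ⟨ε, h1, h2⟩ := ((hc.eventually hx2).and self_mem_nhdsWithin).exists
    refine ⟨ε, h2, h1 ?_⟩
    have := add_smul_sub_mem_affineSpan hx1 (subset_affineSpan ℝ s hu) (-ε)
    rwa [neg_smul, ← smul_neg, neg_sub] at this
  · rintro ⟨hxs, h⟩
    obtain ⟨y, hy⟩ := Set.Nonempty.intrinsicInterior hs ⟨x, hxs⟩
    obtain ⟨ε, hε, hz⟩ := h y (intrinsicInterior_subset hy)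
    set z := x + ε • (x - y) with hzdef
    obtain ⟨hy1, hy2⟩ := mem_intrinsicInterior_iff_eventually.1 hy
    have hzs := subset_affineSpan ℝ s hz
    refine mem_intrinsicInterior_iff_eventually.2 ⟨subset_affineSpan ℝ s hxs, ?_⟩
    -- The homothety centred at `z` that sends `x` to `y`. It sends nearby points of the affine span
    -- into `s`, and each such `x'` lies between `z` and its image.
    have hc : Filter.Tendsto (fun x' : E => z + ((1 + ε) / ε) • (x' - z)) (𝓝 x) (𝓝 y) := by
      have h1 : Continuous (fun x' : E => z + ((1 + ε) / ε) • (x' - z)) := by fun_prop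
      have h2 : z + ((1 + ε) / ε) • (x - z) = y := by
        rw [hzdef]
        match_scalars <;> field_simp <;> ring
      simpa [h2] using h1.tendsto x
    filter_upwards [hc.eventually hy2] with x' hx' hx's
    have hm := hx' (add_smul_sub_mem_affineSpan hzs hx's _)
    have hcomb := hs hz hm (a := 1 / (1 + ε)) (b := ε / (1 + ε)) (by positivity) (by positivity)
      (by field_simp)
    convert hcomb using 1
    match_scalars <;> field_simp <;> ring

end IntrinsicInterior

/-! ### Superlevel sets, the base polytope and the greedy algorithm -/

section Submodular

variable {V : Type*} [Fintype V]

/-- The set `{w ≥ α}`. -/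
noncomputable def superlevel (w : V → ℝ) (α : ℝ) : Finset V :=
  Finset.univ.filter (fun k => α ≤ w k)

@[simp]
theorem mem_superlevel {w : V → ℝ} {α : ℝ} {k : V} : k ∈ superlevel w α ↔ α ≤ w k := by
  simp [superlevel]

theorem lovasz_eq_integral_superlevel (F : Finset V → ℝ) (w : V → ℝ) :
    lovasz F w = ∫ α : ℝ, F (superlevel w α) := rfl

theorem measurableSet_superlevel_eq (w : V → ℝ) (A : Finset V) :
    MeasurableSet {α | superlevel w α = A} := by
  have : {α | superlevel w α = A} = ⋂ k : V, {α | α ≤ w k ↔ k ∈ A} := by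
    ext α
    simp [Finset.ext_iff]
  rw [this]
  refine MeasurableSet.iInter fun k => ?_
  by_cases hk : k ∈ A
  · simp only [hk, iff_true]
    exact measurableSet_Iic
  · simp only [hk, iff_false, not_le]
    exact measurableSet_Ioi

/-- The integrand takes finitely many values, and a superlevel set other than ∅ and V occurs only
for levels in a bounded interval. -/
theorem integrable_superlevel [DecidableEq V] {H : Finset V → ℝ} (h0 : H ∅ = 0)
    (h1 : H Finset.univ = 0) (w : V → ℝ) : Integrable (fun α => H (superlevel w α)) := by
  have : (fun α => H (superlevel w α)) =
      fun α => ∑ A : Finset V, Set.indicator {α | superlevel w α = A} (fun _ => H A) α := by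
    ext α
    simp [Set.indicator_apply]
  rw [this]
  refine integrable_finsetSum _ fun A _ => ?_
  rw [integrable_indicator_iff (measurableSet_superlevel_eq w A)]
  by_cases hA0 : A = ∅
  · subst hA0
    simp only [h0]
    exact integrableOn_zero
  by_cases hA1 : A = Finset.univ
  · subst hA1
    simp only [h1]
    exact integrableOn_zero
  obtain ⟨i, hi⟩ := Finset.nonempty_iff_ne_empty.2 hA0
  obtain ⟨j, hj⟩ : ∃ j, j ∉ A := by
    by_contra hcon
    push Not at hcon
    exact hA1 (Finset.eq_univ_iff_forall.2 hcon)
  refine integrableOn_const (ne_of_lt ?_)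
  refine lt_of_le_of_lt (measure_mono (t := Set.Icc (w j) (w i)) ?_) measure_Icc_lt_top
  rintro α rfl
  simp only [mem_superlevel, not_le] at hi hj
  exact ⟨hj.le, hi⟩

/-- Layer-cake formula, with levels cut off at a lower bound `c` of `w`: at levels up to `c` the
integrand is the total sum, which is zero, and the terms in `c` cancel for the same reason. -/
theorem integral_sum_superlevel {s : V → ℝ} (hs : ∑ k, s k = 0) (w : V → ℝ) :
    ∫ α : ℝ, ∑ k ∈ superlevel w α, s k = ∑ k, s k * w k := by
  obtain ⟨c, hc⟩ : ∃ c, ∀ k, c ≤ w k := (Set.finite_range w).bddBelow.imp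
    fun c hc k => hc ⟨k, rfl⟩
  have key : ∀ α : ℝ, ∑ k ∈ superlevel w α, s k =
      ∑ k, Set.indicator (Set.Ioc c (w k)) (fun _ => s k) α := by
    intro α
    have h1 : ∑ k ∈ superlevel w α, s k = ∑ k, if α ≤ w k then s k else 0 := by
      rw [superlevel, Finset.sum_filter]
    rw [h1]
    by_cases hα : c < α
    · simp [Set.indicator_apply, hα]
    · push Not at hα
      have : ∀ k, α ≤ w k := fun k => hα.trans (hc k)
      simp [this, hs, not_lt.2 hα]
  simp_rw [key]
  rw [integral_finsetSum]
  · have : ∀ k, ∫ α : ℝ, Set.indicator (Set.Ioc c (w k)) (fun _ => s k) α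
        = s k * w k - s k * c := by
      intro k
      rw [integral_indicator measurableSet_Ioc]
      simp [hc k]
      ring
    simp_rw [this]
    rw [Finset.sum_sub_distrib, ← Finset.sum_mul, hs]
    simp
  · intro k _
    rw [integrable_indicator_iff measurableSet_Ioc]
    exact integrableOn_const (ne_of_lt measure_Ioc_lt_top)

/-- Each superlevel set persists on an interval of positive length, so an identity valid at almost
every level is valid at every level. -/
theorem exists_superlevel_eq_left (w : V → ℝ) (α : ℝ) :
    ∃ a < α, ∀ β ∈ Set.Ioc a α, superlevel w β = superlevel w α := by
  obtain ⟨a, ha, h⟩ : ∃ a < α, ∀ k, w k < α → w k ≤ a := by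
    by_cases hne : (Finset.univ.filter fun k => w k < α).Nonempty
    · obtain ⟨i, hi, hmax⟩ := Finset.exists_max_image _ w hne
      refine ⟨w i, (Finset.mem_filter.1 hi).2, fun k hk => hmax k (by simpa using hk)⟩
    · refine ⟨α - 1, by linarith, fun k hk => absurd ⟨k, by simpa using hk⟩ hne⟩
  refine ⟨a, ha, fun β hβ => ?_⟩
  ext k
  simp only [mem_superlevel]
  refine ⟨fun hk => ?_, fun hk => hβ.2.trans hk⟩
  by_contra hcon
  exact absurd (h k (not_le.1 hcon)) (not_le.2 (lt_of_lt_of_le hβ.1 hk))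

/-- The set `{w > α}` is a superlevel set. -/
theorem exists_superlevel_eq_lt (w : V → ℝ) (α : ℝ) :
    ∃ β, ∀ k, k ∈ superlevel w β ↔ α < w k := by
  by_cases hne : (Finset.univ.filter fun k => α < w k).Nonempty
  · obtain ⟨i, hi, hmin⟩ := Finset.exists_min_image _ w hne
    refine ⟨w i, fun k => ?_⟩
    rw [mem_superlevel]
    exact ⟨fun hk => lt_of_lt_of_le (Finset.mem_filter.1 hi).2 hk,
      fun hk => hmin k (by simpa using hk)⟩
  · obtain ⟨c, hc⟩ : ∃ c, ∀ k, w k ≤ c := (Set.finite_range w).bddAbove.imp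
      fun c hc k => hc ⟨k, rfl⟩
    refine ⟨c + 1, fun k => ?_⟩
    rw [mem_superlevel]
    have h1 : ¬ c + 1 ≤ w k := by linarith [hc k]
    exact iff_of_false h1 fun hk => hne ⟨k, by simpa using hk⟩

theorem superlevel_antitone (w : V → ℝ) : Antitone (superlevel w) := by
  intro a b hab k
  simp only [mem_superlevel]
  exact fun h => hab.trans h

/-- The base polytope of `F`. -/
def basePolytope (F : Finset V → ℝ) : Set (V → ℝ) :=
  {s | (∀ A : Finset V, ∑ k ∈ A, s k ≤ F A) ∧ ∑ k, s k = F Finset.univ}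

/-- The points of the base polytope at which the linear form `w` equals the Lovász extension. -/
def maximizers (F : Finset V → ℝ) (w : V → ℝ) : Set (V → ℝ) :=
  {s | s ∈ basePolytope F ∧ ∑ k, s k * w k = lovasz F w}

variable [DecidableEq V]

theorem lovasz_sub_eq_integral {F : Finset V → ℝ} (h0 : F ∅ = 0) (h1 : F Finset.univ = 0)
    {s : V → ℝ} (hs : s ∈ basePolytope F) (w : V → ℝ) :
    lovasz F w - ∑ k, s k * w k = ∫ α : ℝ, (F (superlevel w α) - ∑ k ∈ superlevel w α, s k) := by
  have hs1 : ∑ k, s k = 0 := hs.2.trans h1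
  rw [integral_sub (integrable_superlevel h0 h1 w)
    (integrable_superlevel (H := fun A => ∑ k ∈ A, s k) (by simp) hs1 w),
    integral_sum_superlevel hs1, lovasz_eq_integral_superlevel]

theorem sum_mul_le_lovasz {F : Finset V → ℝ} (h0 : F ∅ = 0) (h1 : F Finset.univ = 0)
    {s : V → ℝ} (hs : s ∈ basePolytope F) (w : V → ℝ) : ∑ k, s k * w k ≤ lovasz F w := by
  have := lovasz_sub_eq_integral h0 h1 hs w
  have h2 : 0 ≤ ∫ α : ℝ, (F (superlevel w α) - ∑ k ∈ superlevel w α, s k) :=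
    integral_nonneg fun α => sub_nonneg.2 (hs.1 _)
  linarith

/-- A point of the base polytope is a maximizer exactly when all superlevel sets are tight. -/
theorem mem_maximizers_iff {F : Finset V → ℝ} (h0 : F ∅ = 0) (h1 : F Finset.univ = 0)
    {s w : V → ℝ} : s ∈ maximizers F w ↔
      s ∈ basePolytope F ∧ ∀ α, ∑ k ∈ superlevel w α, s k = F (superlevel w α) := by
  refine and_congr_right fun hs => ?_
  have hint := lovasz_sub_eq_integral h0 h1 hs w
  constructor
  · intro heq α
    rw [heq, sub_self] at hint
    have hs1 : ∑ k, s k = 0 := hs.2.trans h1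
    have hae := (integral_eq_zero_iff_of_nonneg
      (f := fun α => F (superlevel w α) - ∑ k ∈ superlevel w α, s k)
      (fun α => sub_nonneg.2 (hs.1 _))
      ((integrable_superlevel h0 h1 w).sub
        (integrable_superlevel (H := fun A => ∑ k ∈ A, s k) (by simp) hs1 w))).1 hint.symm
    obtain ⟨a, ha, hconst⟩ := exists_superlevel_eq_left w α
    by_contra hne
    have hnull := measure_mono_null (s := Set.Ioc a α) (μ := volume) (fun β hβ => by
      simp only [Set.mem_ofPred_eq, Pi.zero_apply, hconst β hβ]
      intro hcon
      exact hne (sub_eq_zero.1 hcon).symm) (ae_iff.1 hae)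
    simp only [Real.volume_Ioc, ENNReal.ofReal_eq_zero] at hnull
    linarith
  · intro h
    have : lovasz F w - ∑ k, s k * w k = 0 := by
      rw [hint]
      simp [h]
    linarith

/-- The greedy algorithm: a point of the base polytope at which all sets of a given chain are
tight. -/
theorem exists_tight_of_isChain {F : Finset V → ℝ} (hsub : IsSubmodular F) (h0 : F ∅ = 0)
    {c : Set (Finset V)} (hc : IsChain (· ⊆ ·) c) :
    ∃ s ∈ basePolytope F, ∀ A ∈ c, ∑ k ∈ A, s k = F A := by
  classical
  -- Elements lying in more members of the chain come first, and an enumeration of V breaks ties.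
  -- Thus `r` is injective and each member of the chain is an initial segment.
  let y : V → ℤ := fun k => -((Finset.univ.filter fun A : Finset V => A ∈ c ∧ k ∈ A).card : ℤ)
  let r : V → ℤ ×ₗ Fin (Fintype.card V) := fun k => toLex (y k, Fintype.equivFin V k)
  have hr : Function.Injective r := by
    intro i j hij
    have := congrArg (fun t => (ofLex t).2) hij
    simpa [r] using this
  let s : V → ℝ := fun k => F (Finset.univ.filter fun j => r j ≤ r k) -
    F (Finset.univ.filter fun j => r j < r k)
  have hle : ∀ A : Finset V, ∑ k ∈ A, s k ≤ F A := by
    intro A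
    induction A using Finset.induction_on_max_value r with
    | empty => simp [h0]
    | insert a A ha hmax ih =>
      rw [Finset.sum_insert ha]
      have hlt : ∀ x ∈ A, r x < r a := fun x hx => lt_of_le_of_ne (hmax x hx)
        fun h => ha (hr h ▸ hx)
      -- Diminishing returns: the increment `s a` over the full initial segment is at most the
      -- increment of `F` from `A` to `insert a A`.
      have h := hsub (insert a A) (Finset.univ.filter fun j => r j < r a)
      have e1 : insert a A ∪ (Finset.univ.filter fun j => r j < r a) =
          Finset.univ.filter fun j => r j ≤ r a := by
        ext j
        simp only [Finset.mem_union, Finset.mem_insert, Finset.mem_filter, Finset.mem_univ,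
          true_and]
        constructor
        · rintro ((rfl | h) | h)
          · exact le_rfl
          · exact hmax j h
          · exact h.le
        · intro h
          rcases h.eq_or_lt with h | h
          · exact Or.inl (Or.inl (hr h))
          · exact Or.inr h
      have e2 : insert a A ∩ (Finset.univ.filter fun j => r j < r a) = A := by
        ext j
        simp only [Finset.mem_inter, Finset.mem_insert, Finset.mem_filter, Finset.mem_univ,
          true_and]
        constructor
        · rintro ⟨rfl | h, h'⟩
          · exact absurd h' (lt_irrefl _)
          · exact h
        · exact fun h => ⟨Or.inr h, hlt j h⟩
      rw [e1, e2] at h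
      have : s a = F (Finset.univ.filter fun j => r j ≤ r a) -
        F (Finset.univ.filter fun j => r j < r a) := rfl
      linarith
  have htight : ∀ A : Finset V, (∀ j ∈ A, ∀ i, r i ≤ r j → i ∈ A) → ∑ k ∈ A, s k = F A := by
    intro A
    induction A using Finset.induction_on_max_value r with
    | empty => simp [h0]
    | insert a A ha hmax ih =>
      intro hlow
      have hlt : ∀ x ∈ A, r x < r a := fun x hx => lt_of_le_of_ne (hmax x hx)
        fun h => ha (hr h ▸ hx)
      have e1 : (Finset.univ.filter fun j => r j ≤ r a) = insert a A := by
        ext j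
        simp only [Finset.mem_insert, Finset.mem_filter, Finset.mem_univ, true_and]
        constructor
        · intro h
          simpa using hlow a (Finset.mem_insert_self _ _) j h
        · rintro (rfl | h)
          · exact le_rfl
          · exact hmax j h
      have e2 : (Finset.univ.filter fun j => r j < r a) = A := by
        ext j
        simp only [Finset.mem_filter, Finset.mem_univ, true_and]
        refine ⟨fun h => ?_, hlt j⟩
        rcases Finset.mem_insert.1 (hlow a (Finset.mem_insert_self _ _) j h.le) with rfl | h'
        · exact absurd h (lt_irrefl _)
        · exact h'
      have hs : s a = F (Finset.univ.filter fun j => r j ≤ r a) -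
        F (Finset.univ.filter fun j => r j < r a) := rfl
      rw [Finset.sum_insert ha, hs, e1, e2, ih]
      · ring
      · intro j hj i hij
        rcases Finset.mem_insert.1 (hlow j (Finset.mem_insert_of_mem hj) i hij) with rfl | h'
        · exact absurd (hlt j hj) (not_lt.2 hij)
        · exact h'
  refine ⟨s, ⟨hle, htight _ fun _ _ i _ => Finset.mem_univ i⟩, fun A hA => htight A ?_⟩
  intro j hj i hij
  by_contra hi
  have hcard : (Finset.univ.filter fun B : Finset V => B ∈ c ∧ i ∈ B).card <
      (Finset.univ.filter fun B : Finset V => B ∈ c ∧ j ∈ B).card := by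
    refine Finset.card_lt_card (Finset.ssubset_iff_of_subset ?_ |>.2
      ⟨A, by simp [hA, hj], by simp [hi]⟩)
    intro B hB
    simp only [Finset.mem_filter, Finset.mem_univ, true_and] at hB ⊢
    refine ⟨hB.1, ?_⟩
    rcases hc.total hA hB.1 with h | h
    · exact h hj
    · exact absurd (h hB.2) hi
  have hlt : r j < r i := by
    rw [Prod.Lex.toLex_lt_toLex]
    left
    simp only [y]
    omega
  exact absurd hij (not_le.2 hlt)

end Submodular

/-! ### Faces of the unit ball and sets of maximizers -/

section Faces

open Topology

variable {V : Type*} [Fintype V]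

theorem sum_mul_combo (s x y : V → ℝ) (a b : ℝ) :
    ∑ k, s k * (a • x + b • y) k = a * ∑ k, s k * x k + b * ∑ k, s k * y k := by
  rw [Finset.mul_sum, Finset.mul_sum, ← Finset.sum_add_distrib]
  refine Finset.sum_congr rfl fun k _ => ?_
  simp only [Pi.add_apply, Pi.smul_apply, smul_eq_mul]
  ring

theorem sum_mul_prolong (s x u : V → ℝ) (ε : ℝ) :
    ∑ k, s k * (x + ε • (x - u)) k = (1 + ε) * ∑ k, s k * x k - ε * ∑ k, s k * u k := by
  rw [show x + ε • (x - u) = (1 + ε) • x + (-ε) • u by module, sum_mul_combo]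
  ring

theorem isChain_range_superlevel (w : V → ℝ) : IsChain (· ⊆ ·) (Set.range (superlevel w)) := by
  rintro _ ⟨a, rfl⟩ _ ⟨b, rfl⟩ _
  rcases le_total a b with h | h
  · exact Or.inr (superlevel_antitone w h)
  · exact Or.inl (superlevel_antitone w h)

/-- Finitely many strict inequalities survive a small displacement. By `maximizers_subset_of_lt`,
the maximizers at the prolonged point are then maximizers at `u`. -/
theorem exists_prolong_order (u v : V → ℝ) :
    ∃ ε : ℝ, 0 < ε ∧ ∀ i j, u i < u j → (u + ε • (u - v)) i < (u + ε • (u - v)) j := by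
  have h : ∀ᶠ ε : ℝ in 𝓝[>] 0, ∀ i j, u i < u j →
      (u + ε • (u - v)) i < (u + ε • (u - v)) j := by
    refine Filter.eventually_all.2 fun i => Filter.eventually_all.2 fun j => ?_
    by_cases hij : u i < u j
    · have hc : ∀ k, Filter.Tendsto (fun ε : ℝ => (u + ε • (u - v)) k) (𝓝[>] 0) (𝓝 (u k)) := by
        intro k
        have : Continuous (fun ε : ℝ => (u + ε • (u - v)) k) := by
          simp only [Pi.add_apply, Pi.smul_apply]
          fun_prop
        simpa using (this.tendsto 0).mono_left nhdsWithin_le_nhds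
      filter_upwards [(hc i).eventually_lt (hc j) hij] with ε hε _ using hε
    · exact Filter.Eventually.of_forall fun ε h => absurd h hij
  obtain ⟨ε, h1, h2⟩ := (h.and self_mem_nhdsWithin).exists
  exact ⟨ε, h2, h1⟩

variable [DecidableEq V] {F : Finset V → ℝ}

theorem maximizers_nonempty (hsub : IsSubmodular F) (h0 : F ∅ = 0) (h1 : F Finset.univ = 0)
    (w : V → ℝ) : (maximizers F w).Nonempty := by
  obtain ⟨s, hs, ht⟩ := exists_tight_of_isChain hsub h0 (isChain_range_superlevel w)
  exact ⟨s, (mem_maximizers_iff h0 h1).2 ⟨hs, fun α => ht _ ⟨α, rfl⟩⟩⟩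

/-- If `x` is ordered compatibly with `u`, then its maximizers are maximizers for `u`. -/
theorem maximizers_subset_of_lt (h0 : F ∅ = 0) (h1 : F Finset.univ = 0) {u x : V → ℝ}
    (h : ∀ i j, u i < u j → x i < x j) : maximizers F x ⊆ maximizers F u := by
  intro s hs
  rw [mem_maximizers_iff h0 h1] at hs ⊢
  refine ⟨hs.1, fun α => ?_⟩
  rcases (superlevel u α).eq_empty_or_nonempty with he | hne
  · simp [he, h0]
  · obtain ⟨i, hi, hmin⟩ := Finset.exists_min_image _ x hne
    have : superlevel u α = superlevel x (x i) := by
      ext k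
      refine ⟨fun hk => mem_superlevel.2 (hmin k hk), fun hk => ?_⟩
      by_contra hcon
      rw [mem_superlevel] at hi hk hcon
      exact absurd (h k i (lt_of_lt_of_le (not_le.1 hcon) hi)) (not_lt.2 hk)
    rw [this]
    exact hs.2 _

/-- A maximizer at the combination is a linear form equal to f there and at most f at `x` and `y`.
-/
theorem lovasz_combo_le (hsub : IsSubmodular F) (h0 : F ∅ = 0) (h1 : F Finset.univ = 0)
    (x y : V → ℝ) {a b : ℝ} (ha : 0 ≤ a) (hb : 0 ≤ b) :
    lovasz F (a • x + b • y) ≤ a * lovasz F x + b * lovasz F y := by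
  obtain ⟨s, hs, heq⟩ := maximizers_nonempty hsub h0 h1 (a • x + b • y)
  rw [← heq, sum_mul_combo]
  exact add_le_add (mul_le_mul_of_nonneg_left (sum_mul_le_lovasz h0 h1 hs x) ha)
    (mul_le_mul_of_nonneg_left (sum_mul_le_lovasz h0 h1 hs y) hb)

theorem lovasz_smul (hsub : IsSubmodular F) (h0 : F ∅ = 0) (h1 : F Finset.univ = 0)
    (w : V → ℝ) {c : ℝ} (hc : 0 < c) : lovasz F (c • w) = c * lovasz F w := by
  obtain ⟨s, hs⟩ := maximizers_nonempty hsub h0 h1 (c • w)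
  have hs' : s ∈ maximizers F w := maximizers_subset_of_lt h0 h1
    (fun i j hij => by simpa using mul_lt_mul_of_pos_left hij hc) hs
  rw [← hs.2, ← hs'.2]
  simpa using sum_mul_combo s w 0 c 0

theorem lovasz_zero (hsub : IsSubmodular F) (h0 : F ∅ = 0) (h1 : F Finset.univ = 0) :
    lovasz F 0 = 0 := by
  obtain ⟨s, hs⟩ := maximizers_nonempty hsub h0 h1 0
  rw [← hs.2]
  simp

theorem convex_unitBall (hsub : IsSubmodular F) (h0 : F ∅ = 0) (h1 : F Finset.univ = 0) :
    Convex ℝ (unitBall F) := by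
  intro x hx y hy a b ha hb hab
  have h := lovasz_combo_le hsub h0 h1 x y ha hb
  have hx' : lovasz F x ≤ 1 := hx
  have hy' : lovasz F y ≤ 1 := hy
  change lovasz F (a • x + b • y) ≤ 1
  nlinarith

theorem exists_prolong_mem_unitBall (hsub : IsSubmodular F) (h0 : F ∅ = 0)
    (h1 : F Finset.univ = 0) {x : V → ℝ} (hx : lovasz F x < 1) (u : V → ℝ) :
    ∃ ε : ℝ, 0 < ε ∧ x + ε • (x - u) ∈ unitBall F := by
  set M := |lovasz F (x - u)| + 1 with hM
  have hMpos : 0 < M := by positivity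
  refine ⟨(1 - lovasz F x) / M, div_pos (by linarith) hMpos, ?_⟩
  have hε : 0 ≤ (1 - lovasz F x) / M := div_nonneg (by linarith) hMpos.le
  have h := lovasz_combo_le hsub h0 h1 x (x - u) zero_le_one hε
  rw [one_smul, one_mul] at h
  refine h.trans ?_
  have h2 : (1 - lovasz F x) / M * lovasz F (x - u) ≤ (1 - lovasz F x) / M * M :=
    mul_le_mul_of_nonneg_left (by linarith [le_abs_self (lovasz F (x - u))]) hε
  rw [div_mul_cancel₀ _ hMpos.ne'] at h2
  linarith

theorem intrinsicInterior_unitBall (hsub : IsSubmodular F) (h0 : F ∅ = 0)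
    (h1 : F Finset.univ = 0) : intrinsicInterior ℝ (unitBall F) = {w | lovasz F w < 1} := by
  ext x
  rw [(convex_unitBall hsub h0 h1).mem_intrinsicInterior_iff]
  constructor
  · rintro ⟨hx, h⟩
    refine lt_of_le_of_ne (show lovasz F x ≤ 1 from hx) fun heq => ?_
    obtain ⟨ε, hε, hm⟩ := h 0 (by
      change lovasz F 0 ≤ 1
      rw [lovasz_zero hsub h0 h1]
      exact zero_le_one)
    have hm' : lovasz F (x + ε • (x - 0)) ≤ 1 := hm
    rw [show x + ε • (x - 0) = (1 + ε) • x by module, lovasz_smul hsub h0 h1 _ (by linarith),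
      heq] at hm'
    linarith
  · intro hx
    have hx' : lovasz F x < 1 := hx
    exact ⟨hx'.le, fun u _ => exists_prolong_mem_unitBall hsub h0 h1 hx' u⟩

/-- The face of the unit ball cut out by the maximizers for `w`. -/
def faceAt (F : Finset V → ℝ) (w : V → ℝ) : Set (V → ℝ) :=
  {u | lovasz F u = 1 ∧ maximizers F w ⊆ maximizers F u}

/-- In this form the face is cut from the ball by linear equations that are inequalities on the
whole ball, whence convexity and extremality. -/
theorem mem_faceAt_iff (hsub : IsSubmodular F) (h0 : F ∅ = 0) (h1 : F Finset.univ = 0)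
    {w u : V → ℝ} :
    u ∈ faceAt F w ↔ u ∈ unitBall F ∧ ∀ s ∈ maximizers F w, ∑ k, s k * u k = 1 := by
  constructor
  · rintro ⟨hu, h⟩
    exact ⟨hu.le, fun s hs => (h hs).2.trans hu⟩
  · rintro ⟨hu, h⟩
    obtain ⟨s, hs⟩ := maximizers_nonempty hsub h0 h1 w
    have hu1 : lovasz F u = 1 := le_antisymm hu (by
      rw [← h s hs]
      exact sum_mul_le_lovasz h0 h1 hs.1 u)
    exact ⟨hu1, fun t ht => ⟨ht.1, (h t ht).trans hu1.symm⟩⟩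

theorem convex_faceAt (hsub : IsSubmodular F) (h0 : F ∅ = 0) (h1 : F Finset.univ = 0)
    (w : V → ℝ) : Convex ℝ (faceAt F w) := by
  intro x hx y hy a b ha hb hab
  rw [mem_faceAt_iff hsub h0 h1] at hx hy ⊢
  refine ⟨convex_unitBall hsub h0 h1 hx.1 hy.1 ha hb hab, fun s hs => ?_⟩
  rw [sum_mul_combo, hx.2 s hs, hy.2 s hs]
  linarith

theorem isFace_faceAt (hsub : IsSubmodular F) (h0 : F ∅ = 0) (h1 : F Finset.univ = 0)
    (w : V → ℝ) : IsFace (unitBall F) (faceAt F w) := by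
  refine ⟨convex_faceAt hsub h0 h1 w, fun u hu => hu.1.le, ?_⟩
  rintro x hx y hy z hz ⟨a, b, ha, hb, hab, rfl⟩
  rw [mem_faceAt_iff hsub h0 h1] at hz ⊢
  refine ⟨hx, fun s hs => ?_⟩
  have h := hz.2 s hs
  rw [sum_mul_combo] at h
  have hx' : ∑ k, s k * x k ≤ 1 := (sum_mul_le_lovasz h0 h1 hs.1 x).trans hx
  have hy' : ∑ k, s k * y k ≤ 1 := (sum_mul_le_lovasz h0 h1 hs.1 y).trans hy
  nlinarith

theorem faceAt_ne_unitBall (hsub : IsSubmodular F) (h0 : F ∅ = 0) (h1 : F Finset.univ = 0)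
    (w : V → ℝ) : faceAt F w ≠ unitBall F := by
  intro h
  have hz := lovasz_zero hsub h0 h1
  have : (0 : V → ℝ) ∈ faceAt F w := by
    rw [h]
    change lovasz F 0 ≤ 1
    rw [hz]
    exact zero_le_one
  exact zero_ne_one (hz.symm.trans this.1)

/-- If the segment from `u` to a point of the boundary of the unit ball can be prolonged in the
unit ball, then the maximizers at that point are maximizers for `u`. -/
theorem sum_mul_eq_one_of_prolong (h0 : F ∅ = 0) (h1 : F Finset.univ = 0) {w u s : V → ℝ} {ε : ℝ}
    (hw : lovasz F w = 1) (hu : u ∈ unitBall F) (hε : 0 < ε)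
    (h : w + ε • (w - u) ∈ unitBall F) (hs : s ∈ maximizers F w) : ∑ k, s k * u k = 1 := by
  have h2 : ∑ k, s k * (w + ε • (w - u)) k ≤ 1 := (sum_mul_le_lovasz h0 h1 hs.1 _).trans h
  have h3 : ∑ k, s k * u k ≤ 1 := (sum_mul_le_lovasz h0 h1 hs.1 u).trans hu
  rw [sum_mul_prolong, hs.2, hw] at h2
  nlinarith

/-- Prolonging the segment from `w` beyond `u` forces the maximizers at `u` to be maximizers at `w`.
Conversely, a short prolongation from `v` beyond `u` keeps the strict order of `u`, so some
maximizer of `u` computes f there; it equals 1 at `u` and `v`, hence on their line. -/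
theorem intrinsicInterior_faceAt (hsub : IsSubmodular F) (h0 : F ∅ = 0) (h1 : F Finset.univ = 0)
    {w : V → ℝ} (hw : lovasz F w = 1) : intrinsicInterior ℝ (faceAt F w) =
      {u | lovasz F u = 1 ∧ maximizers F u = maximizers F w} := by
  ext u
  rw [(convex_faceAt hsub h0 h1 w).mem_intrinsicInterior_iff]
  constructor
  · rintro ⟨hu, h⟩
    refine ⟨hu.1, Set.Subset.antisymm (fun s hs => ⟨hs.1, ?_⟩) hu.2⟩
    obtain ⟨ε, hε, hm⟩ := h w ⟨hw, subset_rfl⟩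
    rw [hw]
    exact sum_mul_eq_one_of_prolong h0 h1 hu.1 hw.le hε hm.1.le hs
  · rintro ⟨hu, hM⟩
    refine ⟨⟨hu, hM.superset⟩, fun v hv => ?_⟩
    obtain ⟨ε, hε, hord⟩ := exists_prolong_order u v
    refine ⟨ε, hε, ?_⟩
    have hval : ∀ s ∈ maximizers F w, ∑ k, s k * (u + ε • (u - v)) k = 1 := by
      intro s hs
      rw [sum_mul_prolong, (hM.superset hs).2, (hv.2 hs).2, hu, hv.1]
      ring
    rw [mem_faceAt_iff hsub h0 h1]
    refine ⟨?_, hval⟩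
    obtain ⟨s, hs⟩ := maximizers_nonempty hsub h0 h1 (u + ε • (u - v))
    have := hval s (hM.subset (maximizers_subset_of_lt h0 h1 hord hs))
    exact (hs.2.symm.trans this).le

theorem eq_unitBall_of_lovasz_lt_one (hsub : IsSubmodular F) (h0 : F ∅ = 0)
    (h1 : F Finset.univ = 0) {G : Set (V → ℝ)} (hG : IsFace (unitBall F) G) {w : V → ℝ}
    (hw : w ∈ G) (hlt : lovasz F w < 1) : G = unitBall F := by
  refine Set.Subset.antisymm hG.2.subset fun u hu => ?_
  obtain ⟨ε, hε, hm⟩ := exists_prolong_mem_unitBall hsub h0 h1 hlt u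
  refine hG.2.left_mem_of_mem_openSegment hu hm hw
    ⟨ε / (1 + ε), 1 / (1 + ε), by positivity, by positivity, by field_simp; ring, ?_⟩
  match_scalars <;> field_simp
  ring

/-- Two faces whose relative interiors share a point coincide: segments of either face prolong
beyond `w`, and extremality of the other captures their ends. -/
theorem eq_faceAt_of_mem_intrinsicInterior (hsub : IsSubmodular F) (h0 : F ∅ = 0)
    (h1 : F Finset.univ = 0) {G : Set (V → ℝ)} (hG : IsFace (unitBall F) G) {w : V → ℝ}
    (hw : w ∈ intrinsicInterior ℝ G) (hw1 : lovasz F w = 1) : G = faceAt F w := by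
  obtain ⟨hwG, h⟩ := hG.1.mem_intrinsicInterior_iff.1 hw
  refine Set.Subset.antisymm (fun u hu => ?_) fun u hu => ?_
  · obtain ⟨ε, hε, hm⟩ := h u hu
    rw [mem_faceAt_iff hsub h0 h1]
    exact ⟨hG.2.subset hu, fun s hs =>
      sum_mul_eq_one_of_prolong h0 h1 hw1 (hG.2.subset hu) hε (hG.2.subset hm) hs⟩
  · have hwf : w ∈ intrinsicInterior ℝ (faceAt F w) := by
      rw [intrinsicInterior_faceAt hsub h0 h1 hw1]
      exact ⟨hw1, rfl⟩
    obtain ⟨ε, hε, hm⟩ := ((convex_faceAt hsub h0 h1 w).mem_intrinsicInterior_iff.1 hwf).2 u hu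
    refine hG.2.left_mem_of_mem_openSegment hu.1.le hm.1.le hwG
      ⟨ε / (1 + ε), 1 / (1 + ε), by positivity, by positivity, by field_simp; ring, ?_⟩
    match_scalars <;> field_simp
    ring

/-- The non-empty relative interiors of the proper faces of the unit ball are the classes of
points of the sphere with the same maximizers. -/
theorem intrinsicInterior_proper_faces (hsub : IsSubmodular F) (h0 : F ∅ = 0)
    (h1 : F Finset.univ = 0) :
    {R : Set (V → ℝ) | R.Nonempty ∧
        ∃ G, IsFace (unitBall F) G ∧ G ≠ unitBall F ∧ R = intrinsicInterior ℝ G} =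
      {R | ∃ w, lovasz F w = 1 ∧
        R = {u | lovasz F u = 1 ∧ maximizers F u = maximizers F w}} := by
  ext R
  constructor
  · rintro ⟨⟨w, hw⟩, G, hG, hne, rfl⟩
    have hwG := intrinsicInterior_subset hw
    have hw1 : lovasz F w = 1 := by
      refine le_antisymm (hG.2.subset hwG) (not_lt.1 fun hlt => hne ?_)
      exact eq_unitBall_of_lovasz_lt_one hsub h0 h1 hG hwG hlt
    refine ⟨w, hw1, ?_⟩
    rw [← intrinsicInterior_faceAt hsub h0 h1 hw1,
      ← eq_faceAt_of_mem_intrinsicInterior hsub h0 h1 hG hw hw1]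
  · rintro ⟨w, hw1, rfl⟩
    exact ⟨⟨w, hw1, rfl⟩, faceAt F w, isFace_faceAt hsub h0 h1 w,
      faceAt_ne_unitBall hsub h0 h1 w, (intrinsicInterior_faceAt hsub h0 h1 hw1).symm⟩

end Faces

/-! ### Blocks, ancestors and open cones of a lattice -/

section SetLattice

variable {V : Type*} [Fintype V] {D : Set (Finset V)}

open Classical in
/-- The set of all `k` that belong to every member of `D` containing `j`: the smallest member of
the lattice `D` that contains `j`. -/
noncomputable def lowerHull (D : Set (Finset V)) (j : V) : Finset V :=
  Finset.univ.filter fun k => ∀ T ∈ D, j ∈ T → k ∈ T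

open Classical in
/-- The set of all `k` that are not separated from `j` by a member of `D`. -/
noncomputable def blockOf (D : Set (Finset V)) (j : V) : Finset V :=
  Finset.univ.filter fun k => ∀ T ∈ D, j ∈ T ↔ k ∈ T

theorem mem_lowerHull {j k : V} : k ∈ lowerHull D j ↔ ∀ T ∈ D, j ∈ T → k ∈ T := by
  simp [lowerHull]

theorem mem_blockOf {j k : V} : k ∈ blockOf D j ↔ ∀ T ∈ D, j ∈ T ↔ k ∈ T := by
  simp [blockOf]

theorem self_mem_lowerHull (j : V) : j ∈ lowerHull D j := mem_lowerHull.2 fun _ _ h => h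

theorem self_mem_blockOf (j : V) : j ∈ blockOf D j := mem_blockOf.2 fun _ _ => Iff.rfl

theorem blockOf_subset_lowerHull (j : V) : blockOf D j ⊆ lowerHull D j := fun _ hk =>
  mem_lowerHull.2 fun T hT => (mem_blockOf.1 hk T hT).1

theorem blockOf_eq_of_mem {j k : V} (h : k ∈ blockOf D j) : blockOf D k = blockOf D j := by
  rw [mem_blockOf] at h
  ext i
  rw [mem_blockOf, mem_blockOf]
  exact forall₂_congr fun T hT => by rw [h T hT]

theorem notMem_blockOf_iff {j k : V} (h : k ∈ lowerHull D j) :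
    k ∉ blockOf D j ↔ ∃ T ∈ D, k ∈ T ∧ j ∉ T := by
  rw [mem_lowerHull] at h
  rw [mem_blockOf]
  constructor
  · intro hn
    push Not at hn
    obtain ⟨T, hT, h1 | h1⟩ := hn
    · exact absurd (h T hT h1.1) h1.2
    · exact ⟨T, hT, h1.2, h1.1⟩
  · rintro ⟨T, hT, h1, h2⟩ hn
    exact h2 ((hn T hT).2 h1)

variable [DecidableEq V]

theorem IsSetLattice.lowerHull_mem (hD : IsSetLattice D) (j : V) : lowerHull D j ∈ D := by
  classical
  have h : lowerHull D j = (Finset.univ.filter fun T => T ∈ D ∧ j ∈ T).inf id := by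
    refine le_antisymm (Finset.le_inf fun T hT k hk => ?_) fun k hk => ?_
    · simp only [Finset.mem_filter, Finset.mem_univ, true_and] at hT
      exact mem_lowerHull.1 hk T hT.1 hT.2
    · exact mem_lowerHull.2 fun T hT hj =>
        (Finset.inf_le (f := id) (by simp [hT, hj]) :
          (Finset.univ.filter fun T => T ∈ D ∧ j ∈ T).inf id ≤ T) hk
  rw [h]
  refine Finset.inf_induction (p := fun T => T ∈ D) hD.univ_mem
    (fun S hS T hT => hD.inter_mem S hS T hT) fun T hT => ?_
  simp only [Finset.mem_filter, Finset.mem_univ, true_and] at hT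
  exact hT.1

theorem IsSetLattice.mem_of_lowerHull_subset (hD : IsSetLattice D) {T : Finset V}
    (h : ∀ j ∈ T, lowerHull D j ⊆ T) : T ∈ D := by
  have hT : T = T.sup (lowerHull D) := by
    refine le_antisymm (fun j hj => ?_) (Finset.sup_le h)
    exact Finset.mem_sup.2 ⟨j, hj, self_mem_lowerHull j⟩
  rw [hT]
  exact Finset.sup_induction (p := fun T => T ∈ D) hD.empty_mem
    (fun S hS T hT => hD.union_mem S hS T hT) fun j _ => hD.lowerHull_mem j

/-- This set is both the lower term of a covering pair realising the block of `j` and the union of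
the ancestors of that block. -/
theorem IsSetLattice.lowerHull_sdiff_blockOf_mem (hD : IsSetLattice D) (j : V) :
    lowerHull D j \ blockOf D j ∈ D := by
  refine hD.mem_of_lowerHull_subset fun i hi k hk => ?_
  rw [Finset.mem_sdiff] at hi ⊢
  have hkj : k ∈ lowerHull D j := mem_lowerHull.2 fun T hT hj =>
    mem_lowerHull.1 hk T hT (mem_lowerHull.1 hi.1 T hT hj)
  refine ⟨hkj, ?_⟩
  obtain ⟨T, hT, h1, h2⟩ := (notMem_blockOf_iff hi.1).1 hi.2
  exact (notMem_blockOf_iff hkj).2 ⟨T, hT, mem_lowerHull.1 hk T hT h1, h2⟩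

/-- The blocks of a lattice are the classes of elements that its members do not separate. -/
theorem IsSetLattice.blocks_eq (hD : IsSetLattice D) : blocks D = Set.range (blockOf D) := by
  ext A
  constructor
  · rintro ⟨S, hS, T, hT, hST, hcov, rfl⟩
    obtain ⟨j, hj⟩ := Finset.sdiff_nonempty.2 hST.2
    refine ⟨j, ?_⟩
    rw [Finset.mem_sdiff] at hj
    -- If `R` cut `T \ S`, then `R ∩ T ∪ S` would lie strictly between `S` and `T`.
    have key : ∀ R ∈ D, ∀ i k, i ∈ T \ S → k ∈ T \ S → i ∈ R → k ∈ R := by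
      intro R hR i k hi hk hiR
      rw [Finset.mem_sdiff] at hi hk
      by_contra hkR
      refine hcov _ (hD.union_mem _ (hD.inter_mem R hR T hT) S hS) ⟨?_, ?_⟩
      · refine (Finset.ssubset_iff_of_subset Finset.subset_union_right).2 ⟨i, ?_, hi.2⟩
        simp [hiR, hi.1]
      · refine (Finset.ssubset_iff_of_subset
          (Finset.union_subset Finset.inter_subset_right hST.1)).2 ⟨k, hk.1, ?_⟩
        simp [hkR, hk.2]
    have hj' := Finset.mem_sdiff.2 hj
    ext k
    rw [mem_blockOf]
    constructor
    · intro h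
      exact Finset.mem_sdiff.2 ⟨(h T hT).1 hj.1, fun hk => hj.2 ((h S hS).2 hk)⟩
    · exact fun hk R hR => ⟨key R hR j k hj' hk, key R hR k j hk hj'⟩
  · rintro ⟨j, rfl⟩
    refine ⟨lowerHull D j \ blockOf D j, hD.lowerHull_sdiff_blockOf_mem j, lowerHull D j,
      hD.lowerHull_mem j, ?_, ?_, ?_⟩
    · exact (Finset.ssubset_iff_of_subset Finset.sdiff_subset).2
        ⟨j, self_mem_lowerHull j, by simp [self_mem_blockOf]⟩
    · rintro R hR ⟨h1, h2⟩
      obtain ⟨k, hk, hk'⟩ := Finset.exists_of_ssubset h1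
      have hkb : k ∈ blockOf D j := by
        by_contra hcon
        exact hk' (Finset.mem_sdiff.2 ⟨h2.1 hk, hcon⟩)
      have hj : j ∈ R := (mem_blockOf.1 hkb R hR).2 hk
      exact h2.2 fun i hi => mem_lowerHull.1 hi R hR hj
    · exact (sdiff_sdiff_eq_self (blockOf_subset_lowerHull j)).symm

theorem IsSetLattice.isAncestor_iff (hD : IsSetLattice D) {j k : V} :
    IsAncestor D (blockOf D k) (blockOf D j) ↔ k ∈ lowerHull D j ∧ k ∉ blockOf D j := by
  have hmem : ∀ i, blockOf D i ∈ blocks D := fun i => by rw [hD.blocks_eq]; exact ⟨i, rfl⟩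
  have hsub : ∀ i, ∀ T ∈ D, blockOf D i ⊆ T ↔ i ∈ T := fun i T hT =>
    ⟨fun h => h (self_mem_blockOf i), fun h l hl => (mem_blockOf.1 hl T hT).1 h⟩
  constructor
  · rintro ⟨-, -, hne, h⟩
    refine ⟨mem_lowerHull.2 fun T hT hj => (hsub k T hT).1 (h T hT ((hsub j T hT).2 hj)), ?_⟩
    exact fun hk => hne (blockOf_eq_of_mem hk)
  · rintro ⟨h1, h2⟩
    refine ⟨hmem k, hmem j, fun h => h2 (h ▸ self_mem_blockOf k), fun T hT hj => ?_⟩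
    exact (hsub k T hT).2 (mem_lowerHull.1 h1 T hT ((hsub j T hT).1 hj))

theorem IsSetLattice.ancestorUnion_blockOf (hD : IsSetLattice D) (j : V) :
    ancestorUnion D (blockOf D j) = lowerHull D j \ blockOf D j := by
  ext k
  simp only [ancestorUnion, Finset.mem_filter, Finset.mem_univ, true_and, Finset.mem_sdiff]
  constructor
  · rintro ⟨A', hA', hk⟩
    have hA := hA'.1
    rw [hD.blocks_eq] at hA
    obtain ⟨i, rfl⟩ := hA
    rw [← blockOf_eq_of_mem hk] at hA'
    exact hD.isAncestor_iff.1 hA'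
  · exact fun h => ⟨blockOf D k, hD.isAncestor_iff.2 h, self_mem_blockOf k⟩

/-- The open cone in terms of points instead of blocks. -/
theorem IsSetLattice.mem_openCone_iff (hD : IsSetLattice D) {w : V → ℝ} :
    w ∈ openCone D ↔ (∀ j, ∀ k ∈ blockOf D j, w k = w j) ∧
      ∀ j, ∀ k ∈ lowerHull D j, k ∉ blockOf D j → w j < w k := by
  have hmem : ∀ i, blockOf D i ∈ blocks D := fun i => by rw [hD.blocks_eq]; exact ⟨i, rfl⟩
  constructor
  · rintro ⟨v, h1, h2⟩
    refine ⟨fun j k hk => ?_, fun j k hk hk' => ?_⟩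
    · rw [h1 _ (hmem j) k hk, h1 _ (hmem j) j (self_mem_blockOf j)]
    · rw [h1 _ (hmem j) j (self_mem_blockOf j), h1 _ (hmem k) k (self_mem_blockOf k)]
      exact h2 _ _ (hD.isAncestor_iff.2 ⟨hk, hk'⟩)
  · rintro ⟨h1, h2⟩
    classical
    -- The default value is harmless: blocks are non-empty.
    let v : Finset V → ℝ := fun A => if h : A.Nonempty then w h.choose else 0
    have hv : ∀ j, v (blockOf D j) = w j := by
      intro j
      have hne : (blockOf D j).Nonempty := ⟨j, self_mem_blockOf j⟩
      simp only [v, dif_pos hne]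
      exact h1 j _ hne.choose_spec
    refine ⟨v, ?_, ?_⟩
    · rw [hD.blocks_eq]
      rintro _ ⟨j, rfl⟩ k hk
      rw [hv, h1 j k hk]
    · intro A' A h
      have hA' := h.1
      have hA := h.2.1
      rw [hD.blocks_eq] at hA hA'
      obtain ⟨k, rfl⟩ := hA'
      obtain ⟨j, rfl⟩ := hA
      rw [hv, hv]
      have := hD.isAncestor_iff.1 h
      exact h2 j k this.1 this.2

theorem IsSetLattice.le_of_mem_openCone (hD : IsSetLattice D) {w : V → ℝ} (hw : w ∈ openCone D)
    {j k : V} (hk : k ∈ lowerHull D j) : w j ≤ w k := by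
  rw [hD.mem_openCone_iff] at hw
  by_cases h : k ∈ blockOf D j
  · exact (hw.1 j k h).ge
  · exact (hw.2 j k hk h).le

theorem IsSetLattice.superlevel_mem (hD : IsSetLattice D) {w : V → ℝ} (hw : w ∈ openCone D)
    (α : ℝ) : superlevel w α ∈ D := by
  refine hD.mem_of_lowerHull_subset fun j hj k hk => ?_
  rw [mem_superlevel] at hj ⊢
  exact hj.trans (hD.le_of_mem_openCone hw hk)

theorem IsSetLattice.smul_mem_openCone (hD : IsSetLattice D) {w : V → ℝ} (hw : w ∈ openCone D)
    {c : ℝ} (hc : 0 < c) : c • w ∈ openCone D := by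
  rw [hD.mem_openCone_iff] at hw ⊢
  refine ⟨fun j k hk => ?_, fun j k hk hk' => ?_⟩
  · simp [hw.1 j k hk]
  · simpa using mul_lt_mul_of_pos_left (hw.2 j k hk hk') hc

/-- The number of members of `D` that contain a given point is an element of the open cone. -/
theorem IsSetLattice.openCone_nonempty (hD : IsSetLattice D) : (openCone D).Nonempty := by
  classical
  refine ⟨fun k => ((Finset.univ.filter fun T => T ∈ D ∧ k ∈ T).card : ℝ), ?_⟩
  rw [hD.mem_openCone_iff]
  refine ⟨fun j k hk => ?_, fun j k hk hk' => ?_⟩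
  · congr 2
    ext T
    simp only [Finset.mem_filter, Finset.mem_univ, true_and]
    exact and_congr_right fun hT => (mem_blockOf.1 hk T hT).symm
  · obtain ⟨T, hT, h1, h2⟩ := (notMem_blockOf_iff hk).1 hk'
    rw [Nat.cast_lt]
    refine Finset.card_lt_card ((Finset.ssubset_iff_of_subset ?_).2
      ⟨T, by simp [hT, h1], by simp [h2]⟩)
    intro S hS
    simp only [Finset.mem_filter, Finset.mem_univ, true_and] at hS ⊢
    exact ⟨hS.1, mem_lowerHull.1 hk S hS.1 hS.2⟩

end SetLattice

/-! ### Set identities and slacks -/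

section Finset

variable {V : Type*} [DecidableEq V]

theorem union_union_eq {B C C' A : Finset V} (h : C ∪ C' = A) : (B ∪ C) ∪ (B ∪ C') = B ∪ A := by
  rw [← h, ← Finset.union_union_distrib_left]

theorem union_inter_eq {B C C' : Finset V} (h : Disjoint C C') : (B ∪ C) ∩ (B ∪ C') = B := by
  rw [← Finset.union_inter_distrib_left, Finset.disjoint_iff_inter_eq_empty.1 h,
    Finset.union_empty]

theorem union_inter_union_sdiff {L L' : Finset V} (T : Finset V) (h : L' ⊆ L) :
    L' ∪ T ∩ L ∪ (L' ∪ L \ T) = L := by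
  ext i
  have := @h i
  simp only [Finset.mem_union, Finset.mem_inter, Finset.mem_sdiff]
  tauto

theorem union_inter_inter_union_sdiff (L L' T : Finset V) :
    (L' ∪ T ∩ L) ∩ (L' ∪ L \ T) = L' := by
  ext i
  simp only [Finset.mem_union, Finset.mem_inter, Finset.mem_sdiff]
  tauto

theorem union_union_inter_eq (L A T : Finset V) : L ∪ (L ∪ A) ∩ T = L ∪ A ∩ T := by
  ext i
  simp only [Finset.mem_union, Finset.mem_inter]
  tauto

theorem union_union_union_eq {A B C L : Finset V} (hC : C ⊆ A) (hB : B ⊆ L) :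
    L ∪ C ∪ (B ∪ A) = L ∪ A := by
  rw [Finset.union_union_union_comm, Finset.union_eq_left.2 hB, Finset.union_eq_right.2 hC]

theorem union_inter_union_eq {A B C L : Finset V} (hC : C ⊆ A) (hB : B ⊆ L)
    (hA : ∀ i ∈ A, i ∉ L) : (L ∪ C) ∩ (B ∪ A) = B ∪ C := by
  ext i
  have h3 := @hC i
  have h4 := @hB i
  have h5 := hA i
  simp only [Finset.mem_union, Finset.mem_inter]
  tauto

theorem IsModularOn.slack_add {F : Finset V → ℝ} {D : Set (Finset V)}
    (hmod : IsModularOn F D) (s : V → ℝ) {A B : Finset V}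
    (hA : A ∈ D) (hB : B ∈ D) :
    (F A - ∑ k ∈ A, s k) + (F B - ∑ k ∈ B, s k) =
      (F (A ∪ B) - ∑ k ∈ A ∪ B, s k) + (F (A ∩ B) - ∑ k ∈ A ∩ B, s k) := by
  have h1 := hmod A hA B hB
  have h2 := Finset.sum_union_inter (s₁ := A) (s₂ := B) (f := s)
  linarith

end Finset

/-! ### Tight lattices and allowed lattices -/

section TightSets

variable {V : Type*} [Fintype V] [DecidableEq V] {F : Finset V → ℝ} {D : Set (Finset V)}

/-- If `F` is modular on a lattice and all superlevel sets of a point of its open cone are tight,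
then all members of the lattice are tight. -/
theorem IsSetLattice.sum_eq_of_mem_maximizers (hD : IsSetLattice D) (h0 : F ∅ = 0)
    (h1 : F Finset.univ = 0) (hmod : IsModularOn F D) {w s : V → ℝ} (hw : w ∈ openCone D)
    (hs : s ∈ maximizers F w) {T : Finset V} (hT : T ∈ D) : ∑ k ∈ T, s k = F T := by
  rw [mem_maximizers_iff h0 h1] at hs
  have key : ∀ n : ℕ, ∀ α, (superlevel w α).card = n →
      F (T ∩ superlevel w α) - ∑ k ∈ T ∩ superlevel w α, s k = 0 := by
    intro n
    induction n using Nat.strong_induction_on with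
    | _ n ih =>
      intro α hn
      rcases (superlevel w α).eq_empty_or_nonempty with he | hne
      · simp [he, h0]
      obtain ⟨j, hj, hmin⟩ := Finset.exists_min_image _ w hne
      obtain ⟨β, hβ⟩ := exists_superlevel_eq_lt w (w j)
      have hLL : superlevel w β ⊆ superlevel w α := fun k hk =>
        mem_superlevel.2 ((mem_superlevel.1 hj).trans ((hβ k).1 hk).le)
      have hcard : (superlevel w β).card < n := by
        rw [← hn]
        exact Finset.card_lt_card ((Finset.ssubset_iff_of_subset hLL).2
          ⟨j, hj, fun h => lt_irrefl _ ((hβ j).1 h)⟩)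
      have hL := hD.superlevel_mem hw α
      have hL' := hD.superlevel_mem hw β
      have hTL := hD.inter_mem T hT _ hL
      have hX := hD.union_mem _ hL' _ hTL
      -- On the lowest layer of the superlevel set `w` is constant, so distinct blocks there are
      -- incomparable and either side of the cut by `T` may be added to the layers above.
      have hX' : superlevel w β ∪ superlevel w α \ T ∈ D := by
        refine hD.mem_of_lowerHull_subset fun i hi k hk => ?_
        rw [Finset.mem_union, Finset.mem_sdiff] at hi ⊢
        have hik := hD.le_of_mem_openCone hw hk
        rcases hi.symm with hi | hi
        · by_cases hb : k ∈ blockOf D i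
          · refine Or.inr ⟨?_, fun hkT => hi.2 ((mem_blockOf.1 hb T hT).2 hkT)⟩
            exact mem_superlevel.2 ((mem_superlevel.1 hi.1).trans hik)
          · exact Or.inl ((hβ k).2 (lt_of_le_of_lt (hmin i hi.1)
              ((hD.mem_openCone_iff.1 hw).2 i k hk hb)))
        · exact Or.inl ((hβ k).2 (lt_of_lt_of_le ((hβ i).1 hi) hik))
      -- Slacks are non-negative and vanish at both superlevel sets, hence at both cuts. Modularity
      -- and the induction hypothesis then carry this to `T ∩ superlevel w α`.
      have e1 := hmod.slack_add s hX hX'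
      have hI' : T ∩ superlevel w α ∩ superlevel w β = T ∩ superlevel w β := by
        rw [Finset.inter_assoc, Finset.inter_eq_right.2 hLL]
      rw [union_inter_union_sdiff T hLL, union_inter_inter_union_sdiff, hs.2, hs.2] at e1
      have e2 := hmod.slack_add s hTL hL'
      rw [Finset.union_comm, hI', ih _ hcard β rfl, hs.2] at e2
      have p1 := hs.1.1 (superlevel w β ∪ T ∩ superlevel w α)
      have p2 := hs.1.1 (superlevel w β ∪ superlevel w α \ T)
      linarith
  obtain ⟨c, hc⟩ : ∃ c, ∀ k, c ≤ w k := (Set.finite_range w).bddBelow.imp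
    fun c hc k => hc ⟨k, rfl⟩
  have hcu : superlevel w c = Finset.univ :=
    Finset.eq_univ_iff_forall.2 fun k => mem_superlevel.2 (hc k)
  have := key _ c rfl
  rw [hcu, Finset.inter_univ] at this
  linarith

/-- Tightness extends from a lattice to a larger one with the same blocks on which `F` is
modular. -/
theorem IsSetLattice.sum_eq_of_blocks_eq {D' : Set (Finset V)} (hD : IsSetLattice D)
    (hD' : IsSetLattice D') (h0 : F ∅ = 0) (hb : blocks D' = blocks D) (hDD' : D ⊆ D')
    (hmod : IsModularOn F D') {s : V → ℝ} (hs : ∀ T ∈ D, ∑ k ∈ T, s k = F T) {T : Finset V}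
    (hT : T ∈ D') : ∑ k ∈ T, s k = F T := by
  classical
  have key : ∀ n : ℕ, ∀ R ∈ D, R.card = n → F (T ∩ R) - ∑ k ∈ T ∩ R, s k = 0 := by
    intro n
    induction n using Nat.strong_induction_on with
    | _ n ih =>
      intro R hR hn
      rcases R.eq_empty_or_nonempty with he | hne
      · simp [he, h0]
      -- Removing a largest proper member `R'` leaves a single block, which `T` contains or avoids;
      -- so `T ∩ R ∪ R'` is `R` or `R'`, both tight.
      obtain ⟨R', hR', hmax⟩ := Finset.exists_max_image
        (Finset.univ.filter fun S => S ∈ D ∧ S ⊂ R) Finset.card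
        ⟨∅, by simpa [hD.empty_mem] using hne⟩
      simp only [Finset.mem_filter, Finset.mem_univ, true_and] at hR' hmax
      have hblock : R \ R' ∈ blocks D' := by
        rw [hb]
        refine ⟨R', hR'.1, R, hR, hR'.2, fun S hS hSR => ?_, rfl⟩
        exact absurd (hmax S ⟨hS, hSR.2⟩) (not_le.2 (Finset.card_lt_card hSR.1))
      rw [hD'.blocks_eq] at hblock
      obtain ⟨j, hj⟩ := hblock
      have hiff : ∀ k ∈ R, k ∉ R' → (k ∈ T ↔ j ∈ T) := by
        intro k hk hk'
        have : k ∈ blockOf D' j := by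
          rw [hj]
          exact Finset.mem_sdiff.2 ⟨hk, hk'⟩
        exact (mem_blockOf.1 this T hT).symm
      have hcase : T ∩ R ∪ R' ∈ D := by
        by_cases hjT : j ∈ T
        · have : T ∩ R ∪ R' = R := by
            ext k
            have h1 := hiff k
            have h2 := @hR'.2.1 k
            simp only [Finset.mem_union, Finset.mem_inter]
            tauto
          rwa [this]
        · have : T ∩ R ∪ R' = R' := by
            ext k
            have h1 := hiff k
            simp only [Finset.mem_union, Finset.mem_inter]
            tauto
          rw [this]
          exact hR'.1
      have e := hmod.slack_add s (hD'.inter_mem T hT R (hDD' hR)) (hDD' hR'.1)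
      have hI : T ∩ R ∩ R' = T ∩ R' := by
        rw [Finset.inter_assoc, Finset.inter_eq_right.2 hR'.2.1]
      rw [hI, hs _ hcase, hs _ hR'.1,
        ih _ (by rw [← hn]; exact Finset.card_lt_card hR'.2) R' hR'.1 rfl] at e
      linarith
  have := key _ _ hD.univ_mem rfl
  rw [Finset.inter_univ] at this
  linarith

/-- The sets that are tight at all maximizers for `w`. -/
def tightLattice (F : Finset V → ℝ) (w : V → ℝ) : Set (Finset V) :=
  {A | ∀ s ∈ maximizers F w, ∑ k ∈ A, s k = F A}

/-- At each maximizer the slack is non-negative and submodular, so its zeros are stable under union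
and intersection. -/
theorem isSetLattice_tightLattice (hsub : IsSubmodular F) (h0 : F ∅ = 0) (w : V → ℝ) :
    IsSetLattice (tightLattice F w) := by
  have key : ∀ A ∈ tightLattice F w, ∀ B ∈ tightLattice F w, ∀ s ∈ maximizers F w,
      ∑ k ∈ A ∪ B, s k = F (A ∪ B) ∧ ∑ k ∈ A ∩ B, s k = F (A ∩ B) := by
    intro A hA B hB s hs
    have h1 := hA s hs
    have h2 := hB s hs
    have h3 := Finset.sum_union_inter (s₁ := A) (s₂ := B) (f := s)
    have h4 := hsub A B
    have h5 := hs.1.1 (A ∪ B)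
    have h6 := hs.1.1 (A ∩ B)
    constructor <;> linarith
  exact ⟨fun s _ => by simp [h0], fun s hs => hs.1.2,
    fun A hA B hB s hs => (key A hA B hB s hs).1, fun A hA B hB s hs => (key A hA B hB s hs).2⟩

theorem superlevel_mem_tightLattice (h0 : F ∅ = 0) (h1 : F Finset.univ = 0) (w : V → ℝ) (α : ℝ) :
    superlevel w α ∈ tightLattice F w := fun _ hs => ((mem_maximizers_iff h0 h1).1 hs).2 α

theorem isModularOn_tightLattice (hsub : IsSubmodular F) (h0 : F ∅ = 0) (h1 : F Finset.univ = 0)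
    (w : V → ℝ) : IsModularOn F (tightLattice F w) := by
  intro A hA B hB
  obtain ⟨s, hs⟩ := maximizers_nonempty hsub h0 h1 w
  have hL := isSetLattice_tightLattice hsub h0 w
  rw [← hA s hs, ← hB s hs, ← hL.union_mem A hA B hB s hs, ← hL.inter_mem A hA B hB s hs]
  exact Finset.sum_union_inter.symm

/-- A separation into `C` and `C'` makes the slacks of `B ∪ C` and `B ∪ C'` add up to zero at every
maximizer. Then `B ∪ C` is tight and cuts the block. -/
theorem hasInseparableBlocks_tightLattice (hsub : IsSubmodular F) (h0 : F ∅ = 0) (w : V → ℝ) :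
    HasInseparableBlocks F (tightLattice F w) := by
  have hL := isSetLattice_tightLattice hsub h0 w
  intro A hA
  rw [hL.blocks_eq] at hA
  obtain ⟨j, rfl⟩ := hA
  rw [hL.ancestorUnion_blockOf]
  set B := lowerHull (tightLattice F w) j \ blockOf (tightLattice F w) j with hB
  rintro ⟨C, C', ⟨c, hc⟩, ⟨c', hc'⟩, hdisj, hunion, heq⟩
  simp only at heq
  have hBm : B ∈ tightLattice F w := hL.lowerHull_sdiff_blockOf_mem j
  have hBA : B ∪ blockOf (tightLattice F w) j ∈ tightLattice F w := by
    rw [hB, Finset.sdiff_union_of_subset (blockOf_subset_lowerHull j)]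
    exact hL.lowerHull_mem j
  have hBC : B ∪ C ∈ tightLattice F w := by
    intro s hs
    have e := Finset.sum_union_inter (s₁ := B ∪ C) (s₂ := B ∪ C') (f := s)
    rw [union_union_eq hunion, union_inter_eq hdisj, hBm s hs, hBA s hs] at e
    have h1 := hs.1.1 (B ∪ C)
    have h2 := hs.1.1 (B ∪ C')
    linarith
  have hcA : c ∈ blockOf (tightLattice F w) j := hunion ▸ Finset.mem_union_left _ hc
  have hcA' : c' ∈ blockOf (tightLattice F w) j := hunion ▸ Finset.mem_union_right _ hc'
  have h1 := (mem_blockOf.1 hcA _ hBC).2 (Finset.mem_union_right _ hc)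
  have h2 := (mem_blockOf.1 hcA' _ hBC).1 h1
  rcases Finset.mem_union.1 h2 with h | h
  · exact (Finset.mem_sdiff.1 h).2 hcA'
  · exact Finset.disjoint_left.1 hdisj h hc'

theorem isAllowedLattice_tightLattice (hsub : IsSubmodular F) (h0 : F ∅ = 0)
    (h1 : F Finset.univ = 0) (w : V → ℝ) : IsAllowedLattice F (tightLattice F w) := by
  have hL := isSetLattice_tightLattice hsub h0 w
  refine ⟨hL, isModularOn_tightLattice hsub h0 h1 w, hasInseparableBlocks_tightLattice hsub h0 w,
    fun D' hD' hb hmod _ hle => Set.Subset.antisymm (fun T hT s hs => ?_) hle⟩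
  exact hL.sum_eq_of_blocks_eq hD' h0 hb hle hmod (fun S hS => hS s hs) hT

/-- Among the points of the base polytope tight on the superlevel sets of `w`, one is tight on a
given set inserted between two consecutive superlevel sets. -/
theorem exists_mem_maximizers_tight_between (hsub : IsSubmodular F) (h0 : F ∅ = 0)
    (h1 : F Finset.univ = 0) (w : V → ℝ) {α : ℝ} {X : Finset V} (hlt : ∀ k, α < w k → k ∈ X)
    (hle : ∀ k ∈ X, α ≤ w k) : ∃ s ∈ maximizers F w, ∑ k ∈ X, s k = F X := by
  have hchain : IsChain (· ⊆ ·) (insert X (Set.range (superlevel w))) := by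
    refine (isChain_range_superlevel w).insert ?_
    rintro _ ⟨β, rfl⟩ _
    rcases le_or_gt β α with h | h
    · exact Or.inl fun k hk => mem_superlevel.2 (h.trans (hle k hk))
    · exact Or.inr fun k hk => hlt k (lt_of_lt_of_le h (mem_superlevel.1 hk))
  obtain ⟨s, hs, ht⟩ := exists_tight_of_isChain hsub h0 hchain
  exact ⟨s, (mem_maximizers_iff h0 h1).2 ⟨hs, fun β => ht _ (Or.inr ⟨β, rfl⟩)⟩, ht _ (Or.inl rfl)⟩

/-- Every point lies in the open cone of its tight lattice. -/
theorem mem_openCone_tightLattice (hsub : IsSubmodular F) (h0 : F ∅ = 0)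
    (h1 : F Finset.univ = 0) (w : V → ℝ) : w ∈ openCone (tightLattice F w) := by
  have hL := isSetLattice_tightLattice hsub h0 w
  have hlev := superlevel_mem_tightLattice h0 h1 w
  have hle : ∀ j, ∀ k ∈ lowerHull (tightLattice F w) j, w j ≤ w k := fun j k hk =>
    mem_superlevel.1 (mem_lowerHull.1 hk _ (hlev (w j)) (mem_superlevel.2 le_rfl))
  rw [hL.mem_openCone_iff]
  refine ⟨fun j k hk => le_antisymm ?_ (hle j k (blockOf_subset_lowerHull j hk)),
    fun j k hk hk' => lt_of_le_of_ne (hle j k hk) fun heq => ?_⟩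
  · exact mem_superlevel.1 ((mem_blockOf.1 hk _ (hlev (w k))).2 (mem_superlevel.2 le_rfl))
  -- If `w` took equal values at `j` and `k`, cutting their layer along `T` would give a tight set
  -- containing `k` but not `j`. The sum over the complementary cut is then the same at all
  -- maximizers, and a greedy maximizer shows that it is the value of `F`; this cut contains `j` but
  -- not `k`.
  obtain ⟨T, hT, hkT, hjT⟩ := (notMem_blockOf_iff hk).1 hk'
  obtain ⟨β, hβ⟩ := exists_superlevel_eq_lt w (w j)
  set L := superlevel w (w j) with hLdef
  set L' := superlevel w β with hLdef'
  have hLL : L' ⊆ L := fun i hi => mem_superlevel.2 ((hβ i).1 hi).le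
  have hX : L' ∪ (T ∩ L) ∈ tightLattice F w :=
    hL.union_mem _ (hlev β) _ (hL.inter_mem T hT _ (hlev (w j)))
  have hunion := union_inter_union_sdiff T hLL
  have hinter := union_inter_inter_union_sdiff L L' T
  have hsum : ∀ s ∈ maximizers F w,
      F (L' ∪ (T ∩ L)) + ∑ i ∈ L' ∪ (L \ T), s i = F L + F L' := by
    intro s hs
    have e := Finset.sum_union_inter (s₁ := L' ∪ (T ∩ L)) (s₂ := L' ∪ (L \ T)) (f := s)
    rw [hunion, hinter, hX s hs, hlev _ s hs, hlev _ s hs] at e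
    exact e.symm
  obtain ⟨s₀, hs₀, ht₀⟩ := exists_mem_maximizers_tight_between hsub h0 h1 w (α := w j)
    (X := L' ∪ (L \ T)) (fun i hi => Finset.mem_union_left _ ((hβ i).2 hi)) (fun i hi => by
      rcases Finset.mem_union.1 hi with h | h
      · exact mem_superlevel.1 (hLL h)
      · exact mem_superlevel.1 (Finset.mem_sdiff.1 h).1)
  have hX' : L' ∪ (L \ T) ∈ tightLattice F w := by
    intro s hs
    have e1 := hsum s hs
    have e2 := hsum s₀ hs₀
    linarith
  have hj : j ∈ L' ∪ (L \ T) :=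
    Finset.mem_union_right _ (Finset.mem_sdiff.2 ⟨mem_superlevel.2 le_rfl, hjT⟩)
  rcases Finset.mem_union.1 (mem_lowerHull.1 hk _ hX' hj) with h | h
  · exact absurd ((hβ k).1 h) (by rw [heq]; exact lt_irrefl _)
  · exact (Finset.mem_sdiff.1 h).2 hkT

/-- For `u` in the cone, superlevel sets of `u` belong to the lattice, and maximizers at `u` are
tight on the whole lattice, including superlevel sets of `w`. Conversely, the lattice depends only
on the maximizers. -/
theorem mem_openCone_tightLattice_iff (hsub : IsSubmodular F) (h0 : F ∅ = 0)
    (h1 : F Finset.univ = 0) {w u : V → ℝ} :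
    u ∈ openCone (tightLattice F w) ↔ maximizers F u = maximizers F w := by
  constructor
  · intro hu
    have hL := isSetLattice_tightLattice hsub h0 w
    have hmod := isModularOn_tightLattice hsub h0 h1 w
    refine Set.Subset.antisymm (fun s hs => ?_) fun s hs => ?_
    · exact (mem_maximizers_iff h0 h1).2 ⟨hs.1, fun α =>
        hL.sum_eq_of_mem_maximizers h0 h1 hmod hu hs (superlevel_mem_tightLattice h0 h1 w α)⟩
    · exact (mem_maximizers_iff h0 h1).2 ⟨hs.1, fun α => hL.superlevel_mem hu α s hs⟩
  · intro h
    have : tightLattice F w = tightLattice F u := by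
      unfold tightLattice
      rw [h]
    rw [this]
    exact mem_openCone_tightLattice hsub h0 h1 u

/-- If `F` is modular on a lattice with inseparable blocks, then the tight sets at a point of the
open cone do not cut the blocks. -/
theorem IsSetLattice.mem_of_mem_tightLattice (hD : IsSetLattice D) (hsub : IsSubmodular F)
    (h0 : F ∅ = 0) (h1 : F Finset.univ = 0) (hmod : IsModularOn F D)
    (hins : HasInseparableBlocks F D) {w : V → ℝ} (hw : w ∈ openCone D) {T : Finset V}
    (hT : T ∈ tightLattice F w) {j k : V} (hjk : k ∈ blockOf D j) (hj : j ∈ T) : k ∈ T := by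
  by_contra hk
  have hDT : D ⊆ tightLattice F w := fun S hS s hs =>
    hD.sum_eq_of_mem_maximizers h0 h1 hmod hw hs hS
  have hL := isSetLattice_tightLattice hsub h0 w
  have hcone := hD.mem_openCone_iff.1 hw
  set A := blockOf D j with hA
  have hAm : A ∈ blocks D := by rw [hD.blocks_eq]; exact ⟨j, rfl⟩
  have hi := hins A hAm
  rw [hA, hD.ancestorUnion_blockOf, ← hA] at hi
  set B := lowerHull D j \ A with hB
  have hBA : B ∪ A = lowerHull D j := Finset.sdiff_union_of_subset (blockOf_subset_lowerHull j)
  obtain ⟨β, hβ⟩ := exists_superlevel_eq_lt w (w j)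
  set L := superlevel w β with hLdef
  have hLD : L ∈ D := hD.superlevel_mem hw β
  have hBD : B ∈ D := hD.lowerHull_sdiff_blockOf_mem j
  have hBAD : B ∪ A ∈ D := by rw [hBA]; exact hD.lowerHull_mem j
  have hBL : B ⊆ L := fun i hi => (hβ i).2
    (hcone.2 j i (Finset.mem_sdiff.1 hi).1 (Finset.mem_sdiff.1 hi).2)
  have hAL : ∀ i ∈ A, i ∉ L := fun i hi hiL => by
    have h2 := (hβ i).1 hiL
    rw [hcone.1 j i hi] at h2
    exact lt_irrefl _ h2
  have hLA : L ∪ A ∈ D := by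
    have : L ∪ A = L ∪ (B ∪ A) := by
      rw [← Finset.union_assoc, Finset.union_eq_left.2 hBL]
    rw [this]
    exact hD.union_mem _ hLD _ hBAD
  have hCC : A ∩ T ∪ A \ T = A := by rw [Finset.union_comm]; exact Finset.sdiff_union_inter A T
  have hdisj : Disjoint (A ∩ T) (A \ T) := (Finset.disjoint_sdiff_inter A T).symm
  have hLC : L ∪ A ∩ T ∈ tightLattice F w := by
    rw [← union_union_inter_eq]
    exact hL.union_mem _ (hDT hLD) _ (hL.inter_mem _ (hDT hLA) _ hT)
  -- At this maximizer both parts of the cut block are tight over `L`, so `T` separates `A` for the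
  -- increments of `F` over `L`.
  obtain ⟨s, hs, hs'⟩ := exists_mem_maximizers_tight_between hsub h0 h1 w (α := w j)
    (X := L ∪ A \ T) (fun i hi => Finset.mem_union_left _ ((hβ i).2 hi)) (fun i hi => by
      rcases Finset.mem_union.1 hi with h | h
      · exact ((hβ i).1 h).le
      · exact (hcone.1 j i (Finset.mem_sdiff.1 h).1).ge)
  have e1 := Finset.sum_union_inter (s₁ := L ∪ A ∩ T) (s₂ := L ∪ A \ T) (f := s)
  rw [union_union_eq hCC, union_inter_eq hdisj, hLC s hs, hs', hDT hLA s hs, hDT hLD s hs] at e1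
  have e2 := hmod L hLD (B ∪ A) hBAD
  -- The separation descends from `L` to the smaller set `B`: modularity gives `A` the same
  -- increment over both, and the increments completing `C` to `A` can only grow over `B`.
  have hcontract : ∀ C ⊆ A, F (L ∪ A) + F (B ∪ C) ≤ F (L ∪ C) + F (B ∪ A) := by
    intro C hC
    have h := hsub (L ∪ C) (B ∪ A)
    rwa [union_union_union_eq hC hBL, union_inter_union_eq hC hBL hAL] at h
  have e5 : L ∪ (B ∪ A) = L ∪ A := by
    rw [← Finset.union_assoc, Finset.union_eq_left.2 hBL]
  have e6 : L ∩ (B ∪ A) = B := by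
    simpa using union_inter_union_eq (Finset.empty_subset A) hBL hAL
  rw [e5, e6] at e2
  have c1 := hcontract (A ∩ T) Finset.inter_subset_left
  have c2 := hcontract (A \ T) Finset.sdiff_subset
  have c3 := hsub (B ∪ A ∩ T) (B ∪ A \ T)
  rw [union_union_eq hCC, union_inter_eq hdisj] at c3
  refine hi ⟨A ∩ T, A \ T, ⟨j, Finset.mem_inter.2 ⟨self_mem_blockOf j, hj⟩⟩,
    ⟨k, Finset.mem_sdiff.2 ⟨hjk, hk⟩⟩, hdisj, hCC, ?_⟩
  simp only
  linarith

/-- An allowed lattice is the tight lattice of every point of its open cone. -/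
theorem IsAllowedLattice.tightLattice_eq (hD : IsAllowedLattice F D) (hsub : IsSubmodular F)
    (h0 : F ∅ = 0) (h1 : F Finset.univ = 0) {w : V → ℝ} (hw : w ∈ openCone D) :
    tightLattice F w = D := by
  have hL := isSetLattice_tightLattice hsub h0 w
  have hDT : D ⊆ tightLattice F w := fun S hS s hs =>
    hD.isSetLattice.sum_eq_of_mem_maximizers h0 h1 hD.modular hw hs hS
  have hcut := fun T (hT : T ∈ tightLattice F w) (j k : V) (hjk : k ∈ blockOf D j) =>
    hD.isSetLattice.mem_of_mem_tightLattice hsub h0 h1 hD.modular hD.inseparable hw hT hjk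
  -- Only equality of the partitions remains: the larger lattice separates more points, but it cuts
  -- no block.
  refine hD.maximal _ hL ?_ (isModularOn_tightLattice hsub h0 h1 w)
    (hasInseparableBlocks_tightLattice hsub h0 w) hDT
  rw [hL.blocks_eq, hD.isSetLattice.blocks_eq]
  congr 1
  ext j k
  constructor
  · exact fun h => mem_blockOf.2 fun T hT => mem_blockOf.1 h T (hDT hT)
  · intro h
    have h' : j ∈ blockOf D k := by
      rw [blockOf_eq_of_mem h]
      exact self_mem_blockOf j
    exact mem_blockOf.2 fun T hT => ⟨hcut T hT j k h, hcut T hT k j h'⟩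

theorem zero_mem_basePolytope (h0 : F ∅ = 0) (h1 : F Finset.univ = 0)
    (hpos : ∀ A : Finset V, A ≠ ∅ → A ≠ Finset.univ → 0 < F A) :
    (0 : V → ℝ) ∈ basePolytope F := by
  refine ⟨fun A => ?_, by simp [h1]⟩
  simp only [Pi.zero_apply, Finset.sum_const_zero]
  by_cases hA : A = ∅
  · rw [hA, h0]
  by_cases hA' : A = Finset.univ
  · rw [hA', h1]
  exact (hpos A hA hA').le

/-- Zero is a base, so f is non-negative. If f vanished at `w`, zero would be a maximizer and `F`
would vanish on `D`, leaving only ∅ and V. -/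
theorem lovasz_pos_of_mem_openCone (hD : IsSetLattice D) (h0 : F ∅ = 0) (h1 : F Finset.univ = 0)
    (hpos : ∀ A : Finset V, A ≠ ∅ → A ≠ Finset.univ → 0 < F A) (hmod : IsModularOn F D)
    (hne : D ≠ {∅, Finset.univ}) {w : V → ℝ} (hw : w ∈ openCone D) : 0 < lovasz F w := by
  have hz := zero_mem_basePolytope h0 h1 hpos
  have hle := sum_mul_le_lovasz h0 h1 hz w
  simp only [Pi.zero_apply, zero_mul, Finset.sum_const_zero] at hle
  refine lt_of_le_of_ne hle fun heq => hne ?_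
  have hm : (0 : V → ℝ) ∈ maximizers F w := ⟨hz, by simpa using heq⟩
  refine Set.Subset.antisymm (fun T hT => ?_) ?_
  · have h := hD.sum_eq_of_mem_maximizers h0 h1 hmod hw hm hT
    simp only [Pi.zero_apply, Finset.sum_const_zero] at h
    by_contra hcon
    simp only [Set.mem_insert_iff, Set.mem_singleton_iff, not_or] at hcon
    exact (hpos T hcon.1 hcon.2).ne h
  · rintro T (rfl | rfl)
    · exact hD.empty_mem
    · exact hD.univ_mem

/-- If only ∅ and V were tight, every superlevel set would be one of them; zero would be a maximizer
and f would vanish at `w`. -/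
theorem tightLattice_ne (h0 : F ∅ = 0) (h1 : F Finset.univ = 0)
    (hpos : ∀ A : Finset V, A ≠ ∅ → A ≠ Finset.univ → 0 < F A) {w : V → ℝ}
    (hw : lovasz F w = 1) : tightLattice F w ≠ {∅, Finset.univ} := by
  intro h
  have hm : (0 : V → ℝ) ∈ maximizers F w := by
    refine (mem_maximizers_iff h0 h1).2 ⟨zero_mem_basePolytope h0 h1 hpos, fun α => ?_⟩
    have hα := superlevel_mem_tightLattice h0 h1 w α
    rw [h] at hα
    rcases hα with hα | hα
    · simp [hα, h0]
    · rw [Set.mem_singleton_iff] at hα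
      simp [hα, h1]
  have := hm.2
  simp [hw] at this

end TightSets

/-! ### The description of the faces -/

theorem proposition3 (p : ℕ) (F : Finset (Fin p) → ℝ)
    (hsub : IsSubmodular F) (hempty : F ∅ = 0) (huniv : F Finset.univ = 0)
    (hpos : ∀ A : Finset (Fin p), A ≠ ∅ → A ≠ Finset.univ → 0 < F A) :
    {R : Set (Fin p → ℝ) | R.Nonempty ∧
        ∃ G, IsFace (unitBall F) G ∧ G ≠ unitBall F ∧ R = intrinsicInterior ℝ G} =
      {R : Set (Fin p → ℝ) |
        ∃ D, IsAllowedLattice F D ∧ D ≠ {∅, Finset.univ} ∧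
          R = openCone D ∩ {w | lovasz F w = 1}} ∧
    intrinsicInterior ℝ (unitBall F) = {w | lovasz F w < 1} := by
  refine ⟨?_, intrinsicInterior_unitBall hsub hempty huniv⟩
  rw [intrinsicInterior_proper_faces hsub hempty huniv]
  have hcone : ∀ w, {u | lovasz F u = 1 ∧ maximizers F u = maximizers F w} =
      openCone (tightLattice F w) ∩ {w | lovasz F w = 1} := by
    intro w
    ext u
    exact and_comm.trans
      (and_congr_left' (mem_openCone_tightLattice_iff hsub hempty huniv).symm)
  ext R
  constructor
  · rintro ⟨w, hw, rfl⟩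
    exact ⟨tightLattice F w, isAllowedLattice_tightLattice hsub hempty huniv w,
      tightLattice_ne hempty huniv hpos hw, hcone w⟩
  · rintro ⟨D, hD, hne, rfl⟩
    obtain ⟨x, hx⟩ := hD.isSetLattice.openCone_nonempty
    have hfx := lovasz_pos_of_mem_openCone hD.isSetLattice hempty huniv hpos hD.modular hne hx
    have hc := inv_pos.2 hfx
    -- Positive homogeneity moves the point of the cone onto the sphere {f = 1}.
    refine ⟨(lovasz F x)⁻¹ • x, ?_, ?_⟩
    · rw [lovasz_smul hsub hempty huniv x hc, inv_mul_cancel₀ hfx.ne']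
    · rw [hcone, hD.tightLattice_eq hsub hempty huniv
        (hD.isSetLattice.smul_mem_openCone hx hc)]
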